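/- Let $\mathcal H_A,\mathcal H_B,\mathcal H_C$ be finite-dimensional Hilbert spaces, $\rho^{ABC}$ a density operator, and $\{\Lambda^A_u\}_{u\in\mathcal U}$, $\{\Lambda^B_v\}_{v\in\mathcal V}$ POVMs with finitely many outcomes on $\mathcal H_A$ and $\mathcal H_B$. Put $$\lambda^A_u=\mathrm{Tr}\{\Lambda^A_u\rho^A\},\quad \lambda^B_v=\mathrm{Tr}\{\Lambda^B_v\rho^B\},\quad \lambda^{AB}_{uv}=\mathrm{Tr}\{(\Lambda^A_u\otimes\Lambda^B_v)\rho^{AB}\},$$ $$\hat\rho^A_u=\tfrac{1}{\lambda^A_u}\sqrt{\rho^A}\Lambda^A_u\sqrt{\rho^A},\quad \hat\rho^B_v=\tfrac1{\lambda^B_v}\sqrt{\rho^B}\Lambda^B_v\sqrt{\rho^B},\quad \hat\rho^C_{uv}=\tfrac1{\lambda^{AB}_{uv}}\mathrm{Tr}_{AB}\{(\Lambda^A_u\otimes\Lambda^B_v\otimes I^C)\rho^{ABC}\}.$$ For sequences, $\Lambda^A_{u^n}=\bigotimes_i\Lambda^A_{u_i}$, $\hat\rho^A_{u^n}=\bigotimes_i\hat\rho^A_{u_i}$,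 $\lambda^A_{u^n}=\prod_i\lambda^A_{u_i}$, and likewise for $B$, for $AB$ and for $\hat\rho^C_{u^nv^n}$. A sequence is (strongly) $\delta$-typical for a distribution $p$ if every symbol $x$ has empirical frequency within $\delta$ of $p(x)$ and symbols with $p(x)=0$ do not occur. For vectors, $F(\psi,\varphi)=|\langle\psi|\varphi\rangle|^2$, also when they are not normalized. $S$ is the von Neumann entropy and logarithms are to base $2$. For every $\epsilon>0$ there are $\delta_0>0$ and $N$ such that for all $0<\delta\le\delta_0$ and $n\ge N$ there are dimensions $\kappa_A,g_A,\kappa_B,g_B,\kappa_C,g_C\in\mathbb N$ with the following property. Let $|\Psi\rangle\in\mathcal H_A^{\otimes n}\otimes\mathcal H_B^{\otimes n}\otimes\mathcal H_C^{\otimes n}\otimes\mathcal H_R$ be any purification of $(\rho^{ABC})^{\otimes n}$ with finite-dimensional $\mathcal H_R$, and let $u^n(1),\dots,u^n(L)$ and $v^n(1),\dots,v^n(K)$ be any finite lists of $\delta$-typical sequences for $\lambda^A$ and $\lambda^B$. Index $n$-letter objects by $l$, $k$ instead of $u^n(l)$, $v^n(k)$, and define $$|\hat\Psi_1(l)\rangle=\frac{(\sqrt{\Lambda^A_l}\otimes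 I)|\Psi\rangle}{\sqrt{\lambda^A_l}},\quad |\hat\Psi_2(k)\rangle=\frac{(\sqrt{\Lambda^B_k}\otimes I)|\Psi\rangle}{\sqrt{\lambda^B_k}},\quad |\hat\Psi_3(l,k)\rangle=\frac{(\sqrt{\Lambda^A_l\otimes\Lambda^B_k}\otimes I)|\Psi\rangle}{\sqrt{\lambda^{AB}_{l,k}}},$$ the last one for the pairs with $\lambda^{AB}_{l,k}>0$. Then there are projectors $\Pi^A_l$ on $\mathcal H_A^{\otimes n}$, $\Pi^B_k$ on $\mathcal H_B^{\otimes n}$, $\Pi^C_{l,k}$ on $\mathcal H_C^{\otimes n}$ and unitaries $$U^A_p(l):\mathcal H_A^{\otimes n}\to\mathcal H_{A_p}\otimes\mathcal H_{A_g},\quad U^B_p(k):\mathcal H_B^{\otimes n}\to\mathcal H_{B_p}\otimes\mathcal H_{B_g},\quad U^C_p(l,k):\mathcal H_C^{\otimes n}\to\mathcal H_{C_p}\otimes\mathcal H_{C_g}$$ such that, for all $l$ and $k$ (for the claims on $C$: all $l,k$ with $\lambda^{AB}_{l,k}>0$): 1. $\mathrm{Tr}\{(\Pi^A_l\otimes I)\hat\Psi_1(l)\}\ge1-\epsilon$,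 $\mathrm{Tr}\{(\Pi^B_k\otimes I)\hat\Psi_2(k)\}\ge1-\epsilon$ and $\mathrm{Tr}\{(\Pi^C_{l,k}\otimes I)\hat\Psi_3(l,k)\}\ge1-\epsilon$; 2. $F\big(U^A_p(l)|\hat\Psi_1(l)\rangle,\,|0\rangle_{A_p}\otimes(\Pi^A_l\otimes I)|\hat\Psi_1(l)\rangle\big)\ge1-\epsilon$, $F\big(U^B_p(k)|\hat\Psi_2(k)\rangle,\,|0\rangle_{B_p}\otimes(\Pi^B_k\otimes I)|\hat\Psi_2(k)\rangle\big)\ge1-\epsilon$ and $F\big(U^C_p(l,k)|\hat\Psi_3(l,k)\rangle,\,|0\rangle_{C_p}\otimes(\Pi^C_{l,k}\otimes I)|\hat\Psi_3(l,k)\rangle\big)\ge1-\epsilon$, where the range of each projector is identified, by a linear isometry, with a subspace of the corresponding register $A_g$, $B_g$ or $C_g$; 3. $\log\dim\mathcal H_{A_p}\ge\log\dim\mathcal H_A^{\otimes n}-S(\hat\rho^A_l)-n\epsilon$, $\log\dim\mathcal H_{B_p}\ge\log\dim\mathcal H_B^{\otimes n}-S(\hat\rho^B_k)-n\epsilon$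 and $\log\dim\mathcal H_{C_p}\ge\log\dim\mathcal H_C^{\otimes n}-S(\hat\rho^C_{l,k})-n\epsilon$. Here $\dim\mathcal H_{A_p}=\kappa_A$, $\dim\mathcal H_{A_g}=g_A$ for all $l$, and $\dim\mathcal H_{B_p}=\kappa_B$, $\dim\mathcal H_{B_g}=g_B$ for all $k$. For Charlie, $\dim\mathcal H_{C_p}=\kappa_C$ and $\dim\mathcal H_{C_g}=g_C$ for all pairs $(l,k)$ for which $(u^n(l),v^n(k))$ is $\delta$-typical for $\lambda^{AB}$; for the other pairs these dimensions may depend on $(l,k)$. -/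

import Mathlib

open Matrix
open scoped MatrixOrder ComplexOrder Kronecker

noncomputable section

namespace PurityDistillation

/-! ### States, measurements and entropy on finite-dimensional systems

A system with an orthonormal basis indexed by the finite type `X` has Hilbert space `X → ℂ`;
operators are matrices, and `n` copies of the system are indexed by `Fin n → X`. -/

/-- A density operator. -/
structure IsDensity {X : Type*} [Fintype X] (ρ : Matrix X X ℂ) : Prop where
  posSemidef : ρ.PosSemidef
  trace_eq_one : ρ.trace = 1

/-- A POVM with finitely many outcomes. -/
structure IsPOVM {S X : Type*} [Fintype S] [DecidableEq X] (Λ : S → Matrix X X ℂ) : Prop where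
  posSemidef : ∀ s, (Λ s).PosSemidef
  sum_eq_one : ∑ s, Λ s = 1

/-- The von Neumann entropy `S(σ) = -Tr(σ log₂ σ)`, in bits. -/
def entropy {X : Type*} [Fintype X] [DecidableEq X] (σ : Matrix X X ℂ) : ℝ :=
  (cfc Real.negMulLog σ).trace.re / Real.log 2

/-- The tensor product `M₁ ⊗ ⋯ ⊗ Mₙ`. -/
def tensorProd {X : Type*} {n : ℕ} (M : Fin n → Matrix X X ℂ) :
    Matrix (Fin n → X) (Fin n → X) ℂ :=
  Matrix.of fun x y => ∏ i, M i (x i) (y i)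

/-- The marginal `ρ^A` of `ρ^{ABC}`. -/
def margA {A B C : Type*} [Fintype B] [Fintype C] (ρ : Matrix (A × B × C) (A × B × C) ℂ) :
    Matrix A A ℂ :=
  Matrix.of fun a a' => ∑ b, ∑ c, ρ (a, b, c) (a', b, c)

/-- The marginal `ρ^B` of `ρ^{ABC}`. -/
def margB {A B C : Type*} [Fintype A] [Fintype C] (ρ : Matrix (A × B × C) (A × B × C) ℂ) :
    Matrix B B ℂ :=
  Matrix.of fun b b' => ∑ a, ∑ c, ρ (a, b, c) (a, b', c)

/-- The marginal `ρ^{AB}` of `ρ^{ABC}`. -/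
def margAB {A B C : Type*} [Fintype C] (ρ : Matrix (A × B × C) (A × B × C) ℂ) :
    Matrix (A × B) (A × B) ℂ :=
  Matrix.of fun x y => ∑ c, ρ (x.1, x.2, c) (y.1, y.2, c)

/-- The outcome probability `Tr(Λ_s σ)`. -/
def outcomeProb {S X : Type*} [Fintype X] (σ : Matrix X X ℂ) (Λ : S → Matrix X X ℂ) (s : S) : ℝ :=
  (Λ s * σ).trace.re

/-- The product POVM `Λ^A_u ⊗ Λ^B_v`. -/
def prodPOVM {A B S T : Type*} (ΛA : S → Matrix A A ℂ) (ΛB : T → Matrix B B ℂ) (s : S × T) :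
    Matrix (A × B) (A × B) ℂ :=
  ΛA s.1 ⊗ₖ ΛB s.2

/-- The canonical ensemble state `√σ Λ_s √σ / Tr(Λ_s σ)`. -/
def canonState {S X : Type*} [Fintype X] [DecidableEq X] (σ : Matrix X X ℂ)
    (Λ : S → Matrix X X ℂ) (s : S) : Matrix X X ℂ :=
  ((outcomeProb σ Λ s : ℂ)⁻¹) • (CFC.sqrt σ * Λ s * CFC.sqrt σ)

/-- The state of `C` after the outcome `(u, v)` of the measurement of `AB`:
`Tr_{AB} {(Λ^A_u ⊗ Λ^B_v ⊗ I) ρ^{ABC}} / Tr {(Λ^A_u ⊗ Λ^B_v) ρ^{AB}}`. -/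
def condStateC {A B C S T : Type*} [Fintype A] [Fintype B] [Fintype C]
    (ρ : Matrix (A × B × C) (A × B × C) ℂ)
    (ΛA : S → Matrix A A ℂ) (ΛB : T → Matrix B B ℂ) (s : S × T) : Matrix C C ℂ :=
  ((outcomeProb (margAB ρ) (prodPOVM ΛA ΛB) s : ℂ)⁻¹) •
    Matrix.of fun c c' => ∑ x : A × B, ∑ y : A × B,
      prodPOVM ΛA ΛB s x y * ρ (y.1, y.2, c) (x.1, x.2, c')

/-- Probability of a sequence under the product distribution. -/
def seqProb {S : Type*} (p : S → ℝ) {n : ℕ} (s : Fin n → S) : ℝ := ∏ i, p (s i)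

/-- Strong `δ`-typicality of `s` for the distribution `p`: every empirical frequency is
within `δ` of the probability, and symbols of probability zero do not occur. -/
def StronglyTypical {S : Type*} [DecidableEq S] (p : S → ℝ) (δ : ℝ) {n : ℕ} (s : Fin n → S) :
    Prop :=
  ∀ a, |((Finset.univ.filter fun i => s i = a).card : ℝ) / n - p a| ≤ δ ∧
    (p a = 0 → ∀ i, s i ≠ a)

/-! ### Pure states with several subsystems -/

/-- `Ψ`, a vector of `Aⁿ Bⁿ Cⁿ R`, is a purification of `(ρ^{ABC})^{⊗ n}`. -/
def IsPurification {A B C R : Type*} [Fintype R] {n : ℕ}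
    (ρ : Matrix (A × B × C) (A × B × C) ℂ)
    (Ψ : (Fin n → A) × (Fin n → B) × (Fin n → C) × R → ℂ) : Prop :=
  ∀ (a a' : Fin n → A) (b b' : Fin n → B) (c c' : Fin n → C),
    ∑ r, Ψ (a, b, c, r) * star (Ψ (a', b', c', r)) =
      tensorProd (fun _ => ρ) (fun i => (a i, b i, c i)) (fun i => (a' i, b' i, c' i))

/-- The vector `(M ⊗ I_E) ψ`. -/
def act {X Y E : Type*} [Fintype X] (M : Matrix Y X ℂ) (ψ : X × E → ℂ) : Y × E → ℂ :=
  fun z => ∑ x, M z.1 x * ψ (x, z.2)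

/-- The tensor flip `X ⊗ Y ⊗ E ≃ Y ⊗ X ⊗ E`. -/
def swapFirst {X Y E : Type*} (ψ : X × Y × E → ℂ) : Y × X × E → ℂ :=
  fun z => ψ (z.2.1, z.1, z.2.2)

/-- The regrouping `X ⊗ Y ⊗ E ≃ (X ⊗ Y) ⊗ E`. -/
def groupFirst {X Y E : Type*} (ψ : X × Y × E → ℂ) : (X × Y) × E → ℂ :=
  fun z => ψ (z.1.1, z.1.2, z.2)

/-- The post-measurement vector `(√Λ ⊗ I_E) ψ / √p` for a POVM element `Λ` and probability `p`. -/
def postState {X E : Type*} [Fintype X] [DecidableEq X] (Λ : Matrix X X ℂ) (p : ℝ)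
    (ψ : X × E → ℂ) : X × E → ℂ :=
  ((Real.sqrt p : ℂ)⁻¹) • act (CFC.sqrt Λ) ψ

/-- The vector `|0⟩ ⊗ ψ`, with `|0⟩` the first basis vector of a `κ`-dimensional register. -/
def attachZero {κ : ℕ} {X E : Type*} (ψ : X × E → ℂ) : (Fin κ × X) × E → ℂ :=
  fun z => (if (z.1.1 : ℕ) = 0 then 1 else 0) * ψ (z.1.2, z.2)

/-- The fidelity `|⟨ψ, φ⟩|²` of two (not necessarily normalized) vectors. -/
def fidelity {X : Type*} [Fintype X] (ψ φ : X → ℂ) : ℝ := ‖star ψ ⬝ᵥ φ‖ ^ 2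

/-- The weight `Tr {(Q ⊗ I_E) |ψ⟩⟨ψ|} = ⟨ψ| (Q ⊗ I_E) |ψ⟩`. -/
def weight {X E : Type*} [Fintype X] [Fintype E] (Q : Matrix X X ℂ) (ψ : X × E → ℂ) : ℝ :=
  (star ψ ⬝ᵥ act Q ψ).re

/-- `U` is a unitary from `X` onto (purity register of dimension `κ`) `⊗` (garbage register of
dimension `g`), `Q` is a projector on `X` that captures weight at least `1 - ε` of `ψ`, and
`U ψ` has fidelity at least `1 - ε` with `|0⟩ ⊗ Q ψ`. Since `Q ψ` has to be read as a vector of the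
garbage register, the range of `Q` is identified with a subspace of that register by a partial
isometry `W` with initial projection `Q`. -/
def ExtractsPurity {X E : Type*} [Fintype X] [DecidableEq X] [Fintype E] (ε : ℝ) {κ g : ℕ}
    (U : Matrix (Fin κ × Fin g) X ℂ) (Q : Matrix X X ℂ) (ψ : X × E → ℂ) : Prop :=
  (Uᴴ * U = 1 ∧ U * Uᴴ = 1) ∧
  (Q.IsHermitian ∧ Q * Q = Q) ∧
  (∃ W : Matrix (Fin g) X ℂ, Wᴴ * W = Q ∧
    1 - ε ≤ fidelity (act U ψ) (attachZero (act W (act Q ψ)))) ∧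
  1 - ε ≤ weight Q ψ

end PurityDistillation

end

open PurityDistillation

namespace PurityDistillation

/-! ### Tensor powers of matrices -/

section TensorProd

variable {X : Type*} {n : ℕ}

/-! Both the weight of a projector and the overlap in the fidelity are traces against the reduced
operator of the vector (`weight_eq`, `star_act_dotProduct_act`). The purification therefore enters
only through that operator, which is always a product: of the letters `√Λ σ √Λ / Tr(Λσ)` for Alice
and Bob (`reduced_postState_tensorProd`), and of the conditional states for Charlie
(`reduced_swapFirst_postState_groupFirst`).

A product operator is diagonal in a product basis, with a product distribution as its spectrum.
Chebyshev's inequality for `-log p` (`exists_typicalSet`) gives a set `T` of at most about `2^S`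
eigenvectors that carries almost all the weight. Let `Q` project onto their span, and let `U` rotate
to the eigenbasis and permute it so that `T` lands in `|0⟩ ⊗` garbage. Then `U Q` already has the
form `|0⟩ ⊗ W`, and the overlap equals the weight of `Q` (`exists_extractsPurity`).

The registers must not depend on the codeword. Strong typicality pins the entropy of a codeword near
`n ∑ q S(σ_a)`, so one garbage size fits every typical sequence (`exists_hasExtractor`); atypical
pairs for Charlie get their own sizes. Finally, the canonical states `√σ Λ √σ` of the statement have
the same spectrum as `√Λ σ √Λ`, hence the same entropy (`entropy_canonState`). -/

theorem tensorProd_apply (M : Fin n → Matrix X X ℂ) (x y : Fin n → X) :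
    tensorProd M x y = ∏ i, M i (x i) (y i) := rfl

theorem tensorProd_mul [Fintype X] (M N : Fin n → Matrix X X ℂ) :
    tensorProd M * tensorProd N = tensorProd fun i => M i * N i := by
  classical
  ext x y
  simp only [Matrix.mul_apply, tensorProd_apply, ← Finset.prod_mul_distrib]
  rw [Finset.prod_univ_sum, Fintype.piFinset_univ]

theorem conjTranspose_tensorProd (M : Fin n → Matrix X X ℂ) :
    (tensorProd M)ᴴ = tensorProd fun i => (M i)ᴴ := by
  ext x y
  simp [Matrix.conjTranspose_apply, tensorProd_apply]

theorem tensorProd_diagonal [DecidableEq X] (p : Fin n → X → ℂ) :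
    (tensorProd fun i => diagonal (p i)) = diagonal fun x : Fin n → X => ∏ i, p i (x i) := by
  ext x y
  rw [tensorProd_apply, diagonal_apply]
  split_ifs with h
  · simp [h]
  · obtain ⟨i, hi⟩ := Function.ne_iff.mp h
    exact Finset.prod_eq_zero (Finset.mem_univ i) (diagonal_apply_ne _ hi)

theorem tensorProd_one [DecidableEq X] :
    (tensorProd fun _ : Fin n => (1 : Matrix X X ℂ)) = 1 := by
  simp only [← diagonal_one, tensorProd_diagonal, Finset.prod_const_one]

theorem tensorProd_smul (c : Fin n → ℂ) (M : Fin n → Matrix X X ℂ) :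
    (tensorProd fun i => c i • M i) = (∏ i, c i) • tensorProd M := by
  ext x y
  simp [tensorProd_apply, Finset.prod_mul_distrib]

theorem posSemidef_tensorProd [Fintype X] {M : Fin n → Matrix X X ℂ}
    (h : ∀ i, (M i).PosSemidef) : (tensorProd M).PosSemidef := by
  classical
  have hM : M = fun i => (CFC.sqrt (M i))ᴴ * CFC.sqrt (M i) := by
    funext i
    have h0 : 0 ≤ M i := nonneg_iff_posSemidef.mpr (h i)
    rw [(nonneg_iff_posSemidef.mp (CFC.sqrt_nonneg (M i))).1, CFC.sqrt_mul_sqrt_self _ h0]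
  rw [hM, ← tensorProd_mul, ← conjTranspose_tensorProd]
  exact posSemidef_conjTranspose_mul_self _

theorem conjTranspose_sqrt [Fintype X] [DecidableEq X] (M : Matrix X X ℂ) :
    (CFC.sqrt M)ᴴ = CFC.sqrt M :=
  (nonneg_iff_posSemidef.mp (CFC.sqrt_nonneg M)).1

theorem sqrt_mul_sqrt [Fintype X] [DecidableEq X] {M : Matrix X X ℂ} (h : M.PosSemidef) :
    CFC.sqrt M * CFC.sqrt M = M :=
  CFC.sqrt_mul_sqrt_self _ (nonneg_iff_posSemidef.mpr h)

/-- Uniqueness of the positive square root: the product of the roots is positive and squares to the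
product. -/
theorem sqrt_tensorProd [Fintype X] [DecidableEq X] {M : Fin n → Matrix X X ℂ}
    (h : ∀ i, (M i).PosSemidef) :
    CFC.sqrt (tensorProd M) = tensorProd fun i => CFC.sqrt (M i) := by
  refine CFC.sqrt_unique ?_ (nonneg_iff_posSemidef.mpr (posSemidef_tensorProd fun i =>
    nonneg_iff_posSemidef.mp (CFC.sqrt_nonneg (M i))))
  rw [tensorProd_mul]
  exact congrArg tensorProd (funext fun i => sqrt_mul_sqrt (h i))

end TensorProd

/-! ### Diagonalization and entropy -/

/-- The columns of the unitary `V` are eigenvectors of `σ` with eigenvalues `p`. -/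
structure Diagonalizes {X : Type*} [Fintype X] [DecidableEq X] (V : Matrix X X ℂ) (p : X → ℝ)
    (σ : Matrix X X ℂ) : Prop where
  conjTranspose_mul_self : Vᴴ * V = 1
  mul_conjTranspose_self : V * Vᴴ = 1
  eq : σ = V * diagonal (fun x => (p x : ℂ)) * Vᴴ

section Entropy

variable {X : Type*} [Fintype X] [DecidableEq X]

theorem exists_diagonalizes {σ : Matrix X X ℂ} (h : σ.IsHermitian) :
    Diagonalizes (h.eigenvectorUnitary : Matrix X X ℂ) h.eigenvalues σ where
  conjTranspose_mul_self := Unitary.coe_star_mul_self _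
  mul_conjTranspose_self := Unitary.coe_mul_star_self _
  eq := h.spectral_theorem

namespace Diagonalizes

variable {V : Matrix X X ℂ} {p : X → ℝ} {σ : Matrix X X ℂ}

theorem isHermitian (h : Diagonalizes V p σ) : σ.IsHermitian := by
  rw [h.eq, Matrix.IsHermitian, conjTranspose_mul, conjTranspose_mul, conjTranspose_conjTranspose,
    diagonal_conjTranspose, Matrix.mul_assoc]
  congr 3
  ext x
  simp

theorem roots_charpoly (h : Diagonalizes V p σ) :
    σ.charpoly.roots = Finset.univ.val.map fun x => (p x : ℂ) := by
  rw [h.eq, charpoly_mul_comm, ← Matrix.mul_assoc, h.conjTranspose_mul_self, Matrix.one_mul,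
    charpoly_diagonal, Polynomial.roots_prod _ _ (by
      simp [Finset.prod_ne_zero_iff, Polynomial.X_sub_C_ne_zero])]
  simp

theorem trace_eq (h : Diagonalizes V p σ) : σ.trace = ((∑ x, p x : ℝ) : ℂ) := by
  rw [h.eq, trace_mul_comm, ← Matrix.mul_assoc, h.conjTranspose_mul_self, Matrix.one_mul,
    trace_diagonal]
  push_cast
  rfl

end Diagonalizes

/-- The characteristic polynomial determines the entropy. This frees it from the eigenbasis chosen
by the spectral theorem, and makes it agree on Hermitian operators of the forms `M N` and `N M`. -/
theorem entropy_eq_roots {σ : Matrix X X ℂ} (h : σ.IsHermitian) :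
    entropy σ = (σ.charpoly.roots.map fun z => Real.negMulLog z.re).sum / Real.log 2 := by
  rw [entropy, h.cfc_eq, Matrix.IsHermitian.cfc, (exists_diagonalizes h).roots_charpoly,
    Multiset.map_map, Unitary.conjStarAlgAut_apply, trace_mul_comm, ← Matrix.mul_assoc,
    Unitary.coe_star_mul_self, Matrix.one_mul, trace_diagonal]
  simp

theorem Diagonalizes.entropy_eq {V : Matrix X X ℂ} {p : X → ℝ} {σ : Matrix X X ℂ}
    (h : Diagonalizes V p σ) : entropy σ = (∑ x, Real.negMulLog (p x)) / Real.log 2 := by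
  rw [entropy_eq_roots h.isHermitian, h.roots_charpoly, Multiset.map_map]
  simp

theorem Diagonalizes.tensorProd {n : ℕ} {V : Fin n → Matrix X X ℂ} {p : Fin n → X → ℝ}
    {σ : Fin n → Matrix X X ℂ} (h : ∀ i, Diagonalizes (V i) (p i) (σ i)) :
    Diagonalizes (tensorProd V) (fun x => ∏ i, p i (x i)) (tensorProd σ) where
  conjTranspose_mul_self := by
    rw [conjTranspose_tensorProd, tensorProd_mul, ← tensorProd_one]
    exact congrArg _ (funext fun i => (h i).conjTranspose_mul_self)
  mul_conjTranspose_self := by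
    rw [conjTranspose_tensorProd, tensorProd_mul, ← tensorProd_one]
    exact congrArg _ (funext fun i => (h i).mul_conjTranspose_self)
  eq := by
    push_cast
    rw [conjTranspose_tensorProd, ← tensorProd_diagonal fun i x => (p i x : ℂ), tensorProd_mul,
      tensorProd_mul]
    exact congrArg _ (funext fun i => (h i).eq)

theorem IsDensity.exists_diagonalizes {σ : Matrix X X ℂ} (h : IsDensity σ) :
    ∃ V p, Diagonalizes V p σ ∧ (∀ x, 0 ≤ p x) ∧ ∑ x, p x = 1 := by
  have hd := PurityDistillation.exists_diagonalizes h.posSemidef.1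
  refine ⟨_, _, hd, fun x => h.posSemidef.eigenvalues_nonneg x, ?_⟩
  have := hd.trace_eq
  rw [h.trace_eq_one] at this
  exact_mod_cast this.symm

end Entropy

/-! ### Product distributions -/

theorem sum_prod_apply {R X : Type*} [CommSemiring R] [Fintype X] {n : ℕ} (f : Fin n → X → R) :
    ∑ x : Fin n → X, ∏ i, f i (x i) = ∏ i, ∑ a, f i a := by
  classical
  rw [Finset.prod_univ_sum, Fintype.piFinset_univ]

section ProductDistribution

variable {X : Type*} [Fintype X] {n : ℕ} {p : Fin n → X → ℝ}

theorem sum_prod_mul_apply (hp : ∀ i, ∑ a, p i a = 1) (i : Fin n) (f : X → ℝ) :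
    ∑ x : Fin n → X, (∏ k, p k (x k)) * f (x i) = ∑ a, p i a * f a := by
  have h (x : Fin n → X) : (∏ k, p k (x k)) * f (x i) =
      ∏ k, p k (x k) * (if k = i then f (x k) else 1) := by
    rw [Finset.prod_mul_distrib, Finset.prod_ite_eq' Finset.univ i fun k => f (x k)]
    simp
  simp only [h]
  rw [sum_prod_apply fun k a => p k a * (if k = i then f a else 1),
    Finset.prod_eq_single i (fun k _ hk => by simp [hk, hp]) (by simp)]
  simp

theorem sum_prod_mul_apply_mul_apply {i j : Fin n} (hij : i ≠ j) (f g : X → ℝ)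
    (hf : ∑ a, p i a * f a = 0) :
    ∑ x : Fin n → X, (∏ k, p k (x k)) * (f (x i) * g (x j)) = 0 := by
  have h (x : Fin n → X) : (∏ k, p k (x k)) * (f (x i) * g (x j)) =
      ∏ k, p k (x k) * ((if k = i then f (x k) else 1) * (if k = j then g (x k) else 1)) := by
    rw [Finset.prod_mul_distrib, Finset.prod_mul_distrib,
      Finset.prod_ite_eq' Finset.univ i fun k => f (x k),
      Finset.prod_ite_eq' Finset.univ j fun k => g (x k)]
    simp
  simp only [h]
  rw [sum_prod_apply fun k a =>
    p k a * ((if k = i then f a else 1) * (if k = j then g a else 1))]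
  exact Finset.prod_eq_zero (Finset.mem_univ i) (by simpa [hij] using hf)

/-- Variances of independent centred variables add, because the cross terms factor through a zero
mean. -/
theorem sum_prod_mul_sq_sum (hp : ∀ i, ∑ a, p i a = 1) (Z : Fin n → X → ℝ)
    (hZ : ∀ i, ∑ a, p i a * Z i a = 0) :
    ∑ x : Fin n → X, (∏ k, p k (x k)) * (∑ i, Z i (x i)) ^ 2 = ∑ i, ∑ a, p i a * Z i a ^ 2 := by
  simp only [sq, Finset.sum_mul_sum]
  simp only [Finset.mul_sum]
  rw [Finset.sum_comm]
  refine Finset.sum_congr rfl fun i _ => ?_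
  rw [Finset.sum_comm, Finset.sum_eq_single i]
  · exact sum_prod_mul_apply hp i fun a => Z i a * Z i a
  · exact fun j _ hj => sum_prod_mul_apply_mul_apply hj.symm (Z i) (Z j) (hZ i)
  · simp

theorem sum_negMulLog_prod (hp : ∀ i, ∑ a, p i a = 1) :
    ∑ x : Fin n → X, Real.negMulLog (∏ i, p i (x i)) = ∑ i, ∑ a, Real.negMulLog (p i a) := by
  have h (x : Fin n → X) : Real.negMulLog (∏ i, p i (x i)) =
      -- The logarithm of the product splits only when no factor vanishes; otherwise the weight in
      -- front is zero on both sides.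
      ∑ i, (∏ k, p k (x k)) * -Real.log (p i (x i)) := by
    by_cases hx : ∏ k, p k (x k) = 0
    · simp [hx]
    · rw [Real.negMulLog, Real.log_prod fun i _ => (Finset.prod_ne_zero_iff.mp hx) i
        (Finset.mem_univ i), ← Finset.mul_sum, Finset.sum_neg_distrib]
      ring
  simp only [h]
  rw [Finset.sum_comm]
  refine Finset.sum_congr rfl fun i _ => ?_
  rw [sum_prod_mul_apply hp i fun a => -Real.log (p i a)]
  exact Finset.sum_congr rfl fun a _ => by rw [Real.negMulLog]; ring

/-- The variance of `-log p` under `p`. -/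
noncomputable def logVariance (p : X → ℝ) : ℝ :=
  ∑ a, p a * (-Real.log (p a) - ∑ b, Real.negMulLog (p b)) ^ 2

/-- Sequences whose probability is not much smaller than the exponential of minus the entropy
carry most of the weight, and there are few of them. -/
theorem exists_typicalSet (h0 : ∀ i a, 0 ≤ p i a) (hp : ∀ i, ∑ a, p i a = 1) {t : ℝ} (ht : 0 < t) :
    ∃ T : Finset (Fin n → X),
      (T.card : ℝ) ≤ Real.exp (∑ i, ∑ a, Real.negMulLog (p i a) + t) ∧
      1 - (∑ i, logVariance (p i)) / t ^ 2 ≤ ∑ x ∈ T, ∏ i, p i (x i) := by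
  classical
  set H := ∑ i, ∑ a, Real.negMulLog (p i a) with hH
  have hP0 (x : Fin n → X) : 0 ≤ ∏ i, p i (x i) := Finset.prod_nonneg fun i _ => h0 i _
  have hP1 : ∑ x : Fin n → X, ∏ i, p i (x i) = 1 := by
    rw [sum_prod_apply]
    simp [hp]
  -- Only the lower bound on the probability is imposed: it limits the cardinality, and unusually
  -- likely sequences do no harm.
  set T : Finset (Fin n → X) := {x | Real.exp (-(H + t)) ≤ ∏ i, p i (x i)} with hT
  have hsplit := Finset.sum_add_sum_compl T fun x => ∏ i, p i (x i)
  rw [hP1] at hsplit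
  refine ⟨T, ?_, ?_⟩
  · have h1 : T.card • Real.exp (-(H + t)) ≤ ∑ x ∈ T, ∏ i, p i (x i) :=
      Finset.card_nsmul_le_sum _ _ _ fun x hx => (Finset.mem_filter.mp hx).2
    have h2 : 0 ≤ ∑ x ∈ Tᶜ, ∏ i, p i (x i) := Finset.sum_nonneg fun x _ => hP0 x
    rw [nsmul_eq_mul, Real.exp_neg, ← div_eq_mul_inv, div_le_iff₀ (Real.exp_pos _)] at h1
    nlinarith [Real.exp_pos (H + t)]
  · set Z : Fin n → X → ℝ := fun i a => -Real.log (p i a) - ∑ b, Real.negMulLog (p i b) with hZ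
    have hZ0 (i : Fin n) : ∑ a, p i a * Z i a = 0 := by
      simp only [hZ, mul_sub, Finset.sum_sub_distrib, ← Finset.sum_mul, hp, one_mul]
      rw [sub_eq_zero]
      exact Finset.sum_congr rfl fun a _ => by rw [Real.negMulLog]; ring
    have hvar := sum_prod_mul_sq_sum hp Z hZ0
    have hle : ∑ x ∈ Tᶜ, ∏ i, p i (x i) ≤
        ∑ x : Fin n → X, (∏ k, p k (x k)) * (∑ i, Z i (x i)) ^ 2 / t ^ 2 := by
      refine (Finset.sum_le_sum fun x hx => ?_).trans
        (Finset.sum_le_univ_sum_of_nonneg fun x => div_nonneg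
          (mul_nonneg (hP0 x) (sq_nonneg _)) (sq_nonneg _))
      -- Null sequences lie outside `T` and need not deviate by `t`, since `Real.log 0 = 0`; their
      -- weight is zero.
      rcases (hP0 x).eq_or_lt with h | h
      · simp [← h]
      have hlt : ∏ i, p i (x i) < Real.exp (-(H + t)) := by simpa [hT] using hx
      have hlog := (Real.log_lt_iff_lt_exp h).mpr hlt
      rw [Real.log_prod fun i _ => (Finset.prod_ne_zero_iff.mp h.ne') i (Finset.mem_univ i)] at hlog
      have hZt : t ≤ ∑ i, Z i (x i) := by
        simp only [hZ, Finset.sum_sub_distrib, Finset.sum_neg_distrib]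
        linarith
      rw [le_div_iff₀ (by positivity)]
      exact mul_le_mul_of_nonneg_left (by gcongr) h.le
    rw [← Finset.sum_div, hvar] at hle
    change _ ≤ (∑ i, logVariance (p i)) / t ^ 2 at hle
    linarith

end ProductDistribution

theorem entropy_tensorProd {X : Type*} [Fintype X] [DecidableEq X] {n : ℕ}
    {σ : Fin n → Matrix X X ℂ} (h : ∀ i, IsDensity (σ i)) :
    entropy (tensorProd σ) = ∑ i, entropy (σ i) := by
  choose V p hd _ hp using fun i => (h i).exists_diagonalizes
  rw [(Diagonalizes.tensorProd hd).entropy_eq, sum_negMulLog_prod hp, Finset.sum_div]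
  exact Finset.sum_congr rfl fun i _ => (hd i).entropy_eq.symm

/-! ### Reduced states -/

section Reduced

variable {X Y Z E : Type*}

/-- The coefficient matrix of a bipartite vector. -/
def coeffMatrix {X E : Type*} (ψ : X × E → ℂ) : Matrix X E ℂ := Matrix.of fun x e => ψ (x, e)

theorem coeffMatrix_act [Fintype X] (M : Matrix Y X ℂ) (ψ : X × E → ℂ) :
    coeffMatrix (act M ψ) = M * coeffMatrix ψ := rfl

theorem act_act [Fintype X] [Fintype Y] (M : Matrix Z Y ℂ) (N : Matrix Y X ℂ) (ψ : X × E → ℂ) :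
    act M (act N ψ) = act (M * N) ψ := by
  have h : coeffMatrix (act M (act N ψ)) = coeffMatrix (act (M * N) ψ) := by
    simp only [coeffMatrix_act, Matrix.mul_assoc]
  exact funext fun z => congrFun (congrFun h z.1) z.2

variable [Fintype E]

/-- The reduced operator of `|ψ⟩⟨ψ|` on the first factor. -/
def reduced (ψ : X × E → ℂ) : Matrix X X ℂ := coeffMatrix ψ * (coeffMatrix ψ)ᴴ

theorem reduced_apply (ψ : X × E → ℂ) (x y : X) :
    reduced ψ x y = ∑ e, ψ (x, e) * star (ψ (y, e)) := rfl

theorem star_dotProduct_eq_trace [Fintype X] (ψ φ : X × E → ℂ) :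
    star ψ ⬝ᵥ φ = ((coeffMatrix ψ)ᴴ * coeffMatrix φ).trace := by
  simp only [dotProduct, Matrix.trace, Matrix.diag, Matrix.mul_apply, Fintype.sum_prod_type]
  rw [Finset.sum_comm]
  rfl

theorem star_act_dotProduct_act [Fintype X] [Fintype Y] (M N : Matrix Y X ℂ) (ψ : X × E → ℂ) :
    star (act M ψ) ⬝ᵥ act N ψ = (Mᴴ * N * reduced ψ).trace := by
  rw [star_dotProduct_eq_trace, coeffMatrix_act, coeffMatrix_act, conjTranspose_mul,
    Matrix.mul_assoc, trace_mul_comm, reduced, ← Matrix.mul_assoc, ← Matrix.mul_assoc]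

theorem weight_eq [Fintype X] (Q : Matrix X X ℂ) (ψ : X × E → ℂ) :
    weight Q ψ = (Q * reduced ψ).trace.re := by
  rw [weight, star_dotProduct_eq_trace, coeffMatrix_act, trace_mul_comm, reduced, Matrix.mul_assoc]

theorem reduced_act [Fintype X] (M : Matrix Y X ℂ) (ψ : X × E → ℂ) :
    reduced (act M ψ) = M * reduced ψ * Mᴴ := by
  rw [reduced, coeffMatrix_act, conjTranspose_mul, reduced]
  simp only [Matrix.mul_assoc]

theorem reduced_smul (c : ℝ) (ψ : X × E → ℂ) :
    reduced ((c : ℂ) • ψ) = ((c ^ 2 : ℝ) : ℂ) • reduced ψ := by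
  ext x y
  simp only [reduced_apply, Matrix.smul_apply, smul_eq_mul, Finset.mul_sum, Pi.smul_apply, star_mul']
  refine Finset.sum_congr rfl fun e _ => ?_
  rw [Complex.star_def, Complex.conj_ofReal]
  push_cast
  ring

theorem reduced_postState [Fintype X] [DecidableEq X] (Λ : Matrix X X ℂ) {q : ℝ} (hq : 0 ≤ q)
    (ψ : X × E → ℂ) :
    reduced (postState Λ q ψ) = (q : ℂ)⁻¹ • (CFC.sqrt Λ * reduced ψ * CFC.sqrt Λ) := by
  rw [postState, ← Complex.ofReal_inv, reduced_smul, reduced_act, conjTranspose_sqrt, inv_pow,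
    Real.sq_sqrt hq, Complex.ofReal_inv]

end Reduced

/-! ### Concentration of the weight in a subregister -/

/-- An injection of `T` into the block `|0⟩ ⊗ Fin g` extends to a bijection, as both sides have
equal cardinality. -/
theorem exists_equiv_maps_to_zero {X : Type*} [Fintype X] {κ g : ℕ} (hκ : 0 < κ)
    (hκg : κ * g = Fintype.card X) (T : Finset X) (hT : T.card ≤ g) :
    ∃ e : X ≃ Fin κ × Fin g, ∀ x ∈ T, (e x).1 = ⟨0, hκ⟩ := by
  classical
  have hcard : Fintype.card X = Fintype.card (Fin κ × Fin g) := by simp [hκg]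
  have e₀ := Fintype.equivOfCardEq hcard
  obtain ⟨f⟩ : Nonempty (T ↪ Fin g) := Function.Embedding.nonempty_of_card_le (by simpa using hT)
  set F : X → Fin κ × Fin g :=
    Function.extend Subtype.val (fun t : T => (⟨0, hκ⟩, f t)) e₀ with hF
  have hFT (t : T) : F t = (⟨0, hκ⟩, f t) := Subtype.val_injective.extend_apply _ _ t
  obtain ⟨e, he⟩ := Finset.exists_equiv_extend_of_card_eq (t := Finset.univ)
    (by rw [hcard, Finset.card_univ]) (s := T) (f := F) (Finset.subset_univ _)
    (by
      intro x hx y hy hxy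
      have := (hFT ⟨x, hx⟩).symm.trans (hxy.trans (hFT ⟨y, hy⟩))
      simpa using this)
  refine ⟨e.trans (Equiv.subtypeUnivEquiv fun x => Finset.mem_univ x), fun x hx => ?_⟩
  have := he x hx
  simp [this, hFT ⟨x, hx⟩]

theorem exists_extractsPurity {X : Type*} [Fintype X] [DecidableEq X] {V : Matrix X X ℂ} {p : X → ℝ}
    {σ : Matrix X X ℂ} (hd : Diagonalizes V p σ) {κ g : ℕ} (hκ : 0 < κ)
    (hκg : κ * g = Fintype.card X) (T : Finset X) (hT : T.card ≤ g) {ε : ℝ}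
    (hw : 1 - ε / 2 ≤ ∑ x ∈ T, p x) (hε : 0 ≤ ε) :
    ∃ (Q : Matrix X X ℂ) (U : Matrix (Fin κ × Fin g) X ℂ), ∀ (E : Type*) [Fintype E]
      (ψ : X × E → ℂ), reduced ψ = σ → ExtractsPurity ε U Q ψ := by
  obtain ⟨e, he⟩ := exists_equiv_maps_to_zero hκ hκg T hT
  have hV1 := hd.conjTranspose_mul_self
  have hV2 := hd.mul_conjTranspose_self
  set D : Matrix X X ℂ := diagonal fun x => if x ∈ T then 1 else 0 with hD
  have hDD : D * D = D := by
    rw [hD, diagonal_mul_diagonal]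
    congr 1
    ext x
    simp
  have hDH : Dᴴ = D := by
    rw [hD, diagonal_conjTranspose]
    congr 1
    ext x
    simp only [Pi.star_apply]
    split_ifs <;> simp
  set Q : Matrix X X ℂ := V * D * Vᴴ with hQ
  have hQH : Qᴴ = Q := by
    rw [hQ, conjTranspose_mul, conjTranspose_mul, conjTranspose_conjTranspose, hDH,
      Matrix.mul_assoc]
  have hQQ : Q * Q = Q := by
    calc Q * Q = V * D * (Vᴴ * V) * D * Vᴴ := by simp only [hQ, Matrix.mul_assoc]
      _ = V * (D * D) * Vᴴ := by rw [hV1, Matrix.mul_one, Matrix.mul_assoc V]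
      _ = Q := by rw [hDD]
  set U : Matrix (Fin κ × Fin g) X ℂ := Vᴴ.submatrix e.symm id with hU
  have hUU : Uᴴ * U = 1 := by
    rw [hU, conjTranspose_submatrix, conjTranspose_conjTranspose, submatrix_mul_equiv, hV2]
    simp
  have hUU' : U * Uᴴ = 1 := by
    rw [hU, conjTranspose_submatrix, conjTranspose_conjTranspose,
      ← Matrix.submatrix_mul _ _ _ _ _ Function.bijective_id, hV1]
    exact submatrix_one_equiv _
  have hUQ : U * Q = (D * Vᴴ).submatrix e.symm id := by
    have : U * Q = (Vᴴ * Q).submatrix e.symm id := rfl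
    rw [this, hQ, Matrix.mul_assoc, ← Matrix.mul_assoc, hV1, Matrix.one_mul]
  have hzero (z : Fin κ × Fin g) (hz : z.1 ≠ ⟨0, hκ⟩) (x : X) : (U * Q) z x = 0 := by
    have hzT : e.symm z ∉ T := fun h => hz (by simpa using he _ h)
    rw [hUQ, submatrix_apply, hD, diagonal_mul, if_neg hzT, zero_mul]
  -- `W` is the `|0⟩` block of `U Q`. The other blocks vanish, so no norm is lost and `Wᴴ W = (U Q)ᴴ
  -- (U Q) = Q`.
  set W : Matrix (Fin g) X ℂ := (U * Q).submatrix (fun j => (⟨0, hκ⟩, j)) id with hW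
  have hWW : Wᴴ * W = Q := by
    have h1 : Wᴴ * W = (U * Q)ᴴ * (U * Q) := by
      ext x y
      rw [Matrix.mul_apply, Matrix.mul_apply, Fintype.sum_prod_type]
      symm
      rw [Finset.sum_eq_single_of_mem (⟨0, hκ⟩ : Fin κ) (Finset.mem_univ _) fun i _ hi =>
        Finset.sum_eq_zero fun j _ => by rw [hzero (i, j) hi, mul_zero]]
      rfl
    rw [h1, conjTranspose_mul, Matrix.mul_assoc, ← Matrix.mul_assoc Uᴴ, hUU, Matrix.one_mul, hQH,
      hQQ]
  refine ⟨Q, U, fun E _ ψ hψ => ?_⟩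
  have htr : (Q * reduced ψ).trace = ((∑ x ∈ T, p x : ℝ) : ℂ) := by
    have h1 : Q * σ = V * (D * diagonal fun x => (p x : ℂ)) * Vᴴ := by
      calc Q * σ = V * D * (Vᴴ * V) * (diagonal fun x => (p x : ℂ)) * Vᴴ := by
            rw [hd.eq]
            simp only [hQ, Matrix.mul_assoc]
        _ = _ := by rw [hV1, Matrix.mul_one, Matrix.mul_assoc V]
    rw [hψ, h1, trace_mul_comm, ← Matrix.mul_assoc, hV1, Matrix.one_mul, hD, diagonal_mul_diagonal,
      trace_diagonal]
    push_cast
    simp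
  refine ⟨⟨hUU, hUU'⟩, ⟨hQH, hQQ⟩, ⟨W, hWW, ?_⟩, ?_⟩
  · have hatt : (attachZero (act W (act Q ψ)) : (Fin κ × Fin g) × E → ℂ) = act (U * Q) ψ := by
      funext ⟨⟨i, j⟩, a⟩
      have hWQ : W * Q = W := by
        have : W * Q = (U * Q * Q).submatrix (fun j => ((⟨0, hκ⟩ : Fin κ), j)) id := rfl
        rw [this, Matrix.mul_assoc, hQQ]
      rw [act_act, hWQ]
      by_cases hi : i = ⟨0, hκ⟩
      · subst hi
        simp [attachZero, act, hW]
      · have hi' : (i : ℕ) ≠ 0 := fun h => hi (Fin.ext h)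
        simp [attachZero, act, hi', hzero (i, j) hi]
    rw [fidelity, hatt, star_act_dotProduct_act, ← Matrix.mul_assoc Uᴴ, hUU, Matrix.one_mul, htr,
      Complex.norm_real, Real.norm_eq_abs, sq_abs]
    -- The fidelity is the square of the weight `w`, and `w² ≥ 2w - 1 ≥ 1 - ε`; this is why the
    -- hypothesis asks for `ε / 2`.
    nlinarith [sq_nonneg (∑ x ∈ T, p x - 1)]
  · rw [weight_eq, htr, Complex.ofReal_re]
    linarith

/-! ### Registers and codebooks -/

/-- Both dimensions are powers of `d`, so they divide `d ^ n` exactly. Rounding the garbage exponent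
up to an integer costs at most one factor `d`. -/
theorem exists_register_dims {d : ℕ} (hd : 0 < d) (n : ℕ) {h : ℝ} (hh : 0 ≤ h) :
    ∃ κ g : ℕ, 0 < κ ∧ κ * g = d ^ n ∧
      (∀ t : ℕ, t ≤ d ^ n → (t : ℝ) ≤ 2 ^ h → t ≤ g) ∧
      Real.logb 2 ((d ^ n : ℕ) : ℝ) - h - Real.logb 2 d ≤ Real.logb 2 κ := by
  rcases Nat.eq_or_lt_of_le (Nat.succ_le_of_lt hd) with h1 | h1
  · refine ⟨1, 1, one_pos, by simp [← h1], fun t ht _ => by simpa [← h1] using ht, ?_⟩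
    simp [← h1, hh]
  have hd1 : (1 : ℝ) < d := by exact_mod_cast h1
  set b := Real.logb 2 d with hb
  have hb0 : 0 < b := Real.logb_pos one_lt_two hd1
  set m := ⌈h / b⌉₊ with hm
  have hhm : h ≤ m * b := by
    rw [← div_le_iff₀ hb0]
    exact Nat.le_ceil _
  have hmh : (m : ℝ) * b ≤ h + b := by
    have := (Nat.ceil_lt_add_one (div_nonneg hh hb0.le)).le
    rw [← hm] at this
    calc (m : ℝ) * b ≤ (h / b + 1) * b := by gcongr
      _ = h + b := by field_simp
  -- The minimum covers `h` above `log (d ^ n)`: the whole space is then garbage and `κ = 1`.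
  refine ⟨d ^ (n - min n m), d ^ min n m, by positivity, ?_, fun t ht hth => ?_, ?_⟩
  · rw [← pow_add, Nat.sub_add_cancel (min_le_left _ _)]
  · rcases le_total n m with hnm | hnm
    · rwa [min_eq_left hnm]
    · rw [min_eq_right hnm]
      have h2 : (2 : ℝ) ^ h ≤ (d : ℝ) ^ m := by
        calc (2 : ℝ) ^ h ≤ 2 ^ (b * m) := by
              apply Real.rpow_le_rpow_of_exponent_le one_le_two
              linarith
          _ = (d : ℝ) ^ m := by
              rw [Real.rpow_mul zero_le_two, Real.rpow_natCast, hb,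
                Real.rpow_logb two_pos (by norm_num) (by positivity)]
      exact_mod_cast hth.trans h2
  · push_cast
    rw [Real.logb_pow, Real.logb_pow, Nat.cast_sub (min_le_left _ _), ← hb]
    have : ((min n m : ℕ) : ℝ) ≤ m := by exact_mod_cast min_le_right _ _
    nlinarith

theorem entropy_nonneg {X : Type*} [Fintype X] [DecidableEq X] {σ : Matrix X X ℂ}
    (h : IsDensity σ) : 0 ≤ entropy σ := by
  obtain ⟨V, p, hd, h0, h1⟩ := h.exists_diagonalizes
  rw [hd.entropy_eq]
  refine div_nonneg (Finset.sum_nonneg fun x _ => Real.negMulLog_nonneg (h0 x) ?_)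
    (Real.log_nonneg one_le_two)
  rw [← h1]
  exact Finset.single_le_sum (fun y _ => h0 y) (Finset.mem_univ x)

theorem isDensity_tensorProd {X : Type*} [Fintype X] [DecidableEq X] {n : ℕ}
    {σ : Fin n → Matrix X X ℂ} (h : ∀ i, IsDensity (σ i)) : IsDensity (tensorProd σ) where
  posSemidef := posSemidef_tensorProd fun i => (h i).posSemidef
  trace_eq_one := by
    have : (tensorProd σ).trace = ∏ i, (σ i).trace :=
      sum_prod_apply fun i a => σ i a a
    rw [this]
    exact Finset.prod_eq_one fun i _ => (h i).trace_eq_one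

/-- Grouping the positions by symbol turns the sum into one over empirical frequencies, each within
`δ` of `q`. -/
theorem StronglyTypical.abs_sum_sub_le {S : Type*} [Fintype S] [DecidableEq S] {q : S → ℝ} {δ : ℝ}
    {n : ℕ} (hn : 0 < n) {s : Fin n → S} (hs : StronglyTypical q δ s) (f : S → ℝ) :
    |∑ i, f (s i) - n * ∑ a, q a * f a| ≤ n * δ * ∑ a, |f a| := by
  have hn' : (0 : ℝ) < n := by exact_mod_cast hn
  have h1 : ∑ i, f (s i) = ∑ a, ((Finset.univ.filter fun i => s i = a).card : ℝ) * f a := by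
    rw [← Finset.sum_fiberwise Finset.univ s fun i => f (s i)]
    refine Finset.sum_congr rfl fun a _ => ?_
    rw [Finset.sum_congr rfl fun i hi => by rw [(Finset.mem_filter.mp hi).2], Finset.sum_const,
      nsmul_eq_mul]
  rw [h1, Finset.mul_sum, ← Finset.sum_sub_distrib, Finset.mul_sum]
  refine (Finset.abs_sum_le_sum_abs _ _).trans (Finset.sum_le_sum fun a _ => ?_)
  have h2 : ((Finset.univ.filter fun i => s i = a).card : ℝ) * f a - n * (q a * f a) =
      n * (((Finset.univ.filter fun i => s i = a).card : ℝ) / n - q a) * f a := by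
    field_simp
  rw [h2, abs_mul, abs_mul, abs_of_pos hn']
  gcongr
  exact (hs a).1

theorem exists_extractsPurity_tensorProd {X S : Type*} [Fintype X] [DecidableEq X] [Fintype S]
    (σ : S → Matrix X X ℂ) {ε η : ℝ} (hε : 0 < ε) (hη : 0 < η) :
    ∃ N : ℕ, ∀ n : ℕ, N ≤ n → ∀ s : Fin n → S, (∀ i, IsDensity (σ (s i))) →
      ∀ κ g : ℕ, 0 < κ → κ * g = Fintype.card X ^ n →
      (∀ t : ℕ, t ≤ Fintype.card X ^ n →
        (t : ℝ) ≤ 2 ^ (entropy (tensorProd fun i => σ (s i)) + n * η) → t ≤ g) →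
      ∃ (Q : Matrix (Fin n → X) (Fin n → X) ℂ) (U : Matrix (Fin κ × Fin g) (Fin n → X) ℂ),
        ∀ (E : Type*) [Fintype E] (ψ : (Fin n → X) × E → ℂ),
          reduced ψ = tensorProd (fun i => σ (s i)) → ExtractsPurity ε U Q ψ := by
  have hdiag (a : S) : ∃ (V : Matrix X X ℂ) (p : X → ℝ), IsDensity (σ a) →
      Diagonalizes V p (σ a) ∧ (∀ x, 0 ≤ p x) ∧ ∑ x, p x = 1 := by
    by_cases h : IsDensity (σ a)
    · obtain ⟨V, p, hp⟩ := h.exists_diagonalizes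
      exact ⟨V, p, fun _ => hp⟩
    · exact ⟨0, 0, fun h' => absurd h' h⟩
  choose V p hVp using hdiag
  -- A bound on every single-letter variance makes `N` independent of the sequence. Absolute values
  -- are taken because `p a` is arbitrary where `σ a` is not a density operator.
  set v := ∑ a, |logVariance (p a)| with hv
  have hv0 : 0 ≤ v := Finset.sum_nonneg fun _ _ => abs_nonneg _
  have hlog : 0 < Real.log 2 := Real.log_pos one_lt_two
  -- Chosen so that the Chebyshev error `n v / (n η log 2)²` is at most `ε / 2`; the later `N + 1`
  -- keeps `n` positive.
  obtain ⟨N, hN⟩ := exists_nat_ge (2 * v / (ε * (η * Real.log 2) ^ 2))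
  refine ⟨N + 1, fun n hn s hs κ g hκ hκg hg => ?_⟩
  have hn0 : (0 : ℝ) < n := by exact_mod_cast (Nat.succ_pos N).trans_le hn
  have hNn : 2 * v / (ε * (η * Real.log 2) ^ 2) ≤ n :=
    hN.trans (by exact_mod_cast (Nat.le_succ N).trans hn)
  have hd := Diagonalizes.tensorProd fun i => (hVp (s i) (hs i)).1
  -- The factor `log 2` converts a deviation of `n η` bits into natural units.
  obtain ⟨T, hT, hw⟩ := exists_typicalSet (fun i => (hVp (s i) (hs i)).2.1)
    (fun i => (hVp (s i) (hs i)).2.2) (t := n * η * Real.log 2) (by positivity)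
  refine exists_extractsPurity hd hκ (by simpa using hκg) T (hg _ ?_ ?_) ?_ hε.le
  · simpa using Finset.card_le_univ T
  · refine hT.trans_eq ?_
    rw [hd.entropy_eq, sum_negMulLog_prod fun i => (hVp (s i) (hs i)).2.2,
      Real.rpow_def_of_pos two_pos]
    congr 1
    field_simp
  · refine le_trans ?_ hw
    have hle : ∑ i, logVariance (p (s i)) ≤ n * v := by
      calc ∑ i, logVariance (p (s i)) ≤ ∑ _i : Fin n, v := Finset.sum_le_sum fun i _ =>
            (le_abs_self _).trans (Finset.single_le_sum (f := fun a => |logVariance (p a)|)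
              (fun a _ => abs_nonneg _) (Finset.mem_univ (s i)))
        _ = n * v := by simp
    have : (∑ i, logVariance (p (s i))) / (n * η * Real.log 2) ^ 2 ≤ ε / 2 := by
      rw [div_le_iff₀ (by positivity)] at hNn ⊢
      refine hle.trans ?_
      nlinarith
    linarith

/-- From every vector with reduced operator `σ` one extracts a purity register of dimension
`κ` whose size misses `log d - entropy` by at most `c`. -/
def HasExtractor.{w, v} {X : Type v} [Fintype X] [DecidableEq X] (ε c : ℝ) (σ : Matrix X X ℂ)
    (κ g : ℕ) : Prop :=
  (∃ (Q : Matrix X X ℂ) (U : Matrix (Fin κ × Fin g) X ℂ), ∀ (E : Type w) [Fintype E]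
    (ψ : X × E → ℂ), reduced ψ = σ → ExtractsPurity ε U Q ψ) ∧
  Real.logb 2 (Fintype.card X) - entropy σ - c ≤ Real.logb 2 κ

theorem exists_hasExtractor.{w, v, u} {X : Type v} {S : Type u} [Fintype X] [DecidableEq X]
    [Nonempty X] [Fintype S] [DecidableEq S] (σ : S → Matrix X X ℂ) (q : S → ℝ) (hq : ∀ a, 0 ≤ q a)
    (hσ : ∀ a, q a ≠ 0 → IsDensity (σ a)) {ε : ℝ} (hε : 0 < ε) :
    ∃ δ₀ : ℝ, 0 < δ₀ ∧ ∃ N : ℕ,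
      (∀ δ : ℝ, 0 < δ → δ ≤ δ₀ → ∀ n : ℕ, N ≤ n → ∃ κ g : ℕ, ∀ s : Fin n → S,
        StronglyTypical q δ s →
          HasExtractor.{w} ε (n * ε) (tensorProd fun i => σ (s i)) κ g) ∧
      (∀ n : ℕ, N ≤ n → ∀ s : Fin n → S, (∀ i, q (s i) ≠ 0) → ∃ κ g : ℕ,
        HasExtractor.{w} ε (n * ε) (tensorProd fun i => σ (s i)) κ g) := by
  obtain ⟨N₁, hN₁⟩ := exists_extractsPurity_tensorProd.{v, u, w} σ hε (η := ε / 4) (by positivity)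
  obtain ⟨N₂, hN₂⟩ := exists_nat_ge (Real.logb 2 (Fintype.card X) / (ε / 4))
  have hcard : 0 < Fintype.card X := Fintype.card_pos
  -- Budget for the loss `n ε`: the garbage exponent `h` exceeds the entropy by at least `n ε / 4`,
  -- the typical-set slack, and by at most `3 n ε / 4`; rounding to a power of `d` takes the last `n
  -- ε / 4`.
  have key (n : ℕ) (hn : N₁ + N₂ + 1 ≤ n) (h : ℝ) (hh : 0 ≤ h) : ∃ κ g : ℕ,
      ∀ s : Fin n → S, (∀ i, q (s i) ≠ 0) →
        entropy (tensorProd fun i => σ (s i)) + n * (ε / 4) ≤ h →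
        h ≤ entropy (tensorProd fun i => σ (s i)) + n * (3 * ε / 4) →
        HasExtractor.{w} ε (n * ε) (tensorProd fun i => σ (s i)) κ g := by
    obtain ⟨κ, g, hκ, hκg, hg, hlog⟩ := exists_register_dims hcard n hh
    refine ⟨κ, g, fun s hs h1 h2 => ⟨?_, ?_⟩⟩
    · refine hN₁ n (by omega) s (fun i => hσ _ (hs i)) κ g hκ hκg fun t ht ht' => hg t ht ?_
      exact ht'.trans (Real.rpow_le_rpow_of_exponent_le one_le_two h1)
    · have hN : Real.logb 2 (Fintype.card X) ≤ n * (ε / 4) := by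
        rw [← div_le_iff₀ (by positivity)]
        exact hN₂.trans (by exact_mod_cast (by omega : N₂ ≤ n))
      rw [Fintype.card_fun, Fintype.card_fin]
      linarith
  have hdens {n : ℕ} {s : Fin n → S} (hs : ∀ i, q (s i) ≠ 0) (i : Fin n) : IsDensity (σ (s i)) :=
    hσ _ (hs i)
  set H := ∑ a, q a * entropy (σ a) with hH
  have hH0 : 0 ≤ H := Finset.sum_nonneg fun a _ => by
    by_cases h : q a = 0
    · simp [h]
    · exact mul_nonneg (hq a) (entropy_nonneg (hσ a h))
  set G := ∑ a, |entropy (σ a)| with hG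
  have hG0 : 0 ≤ G := Finset.sum_nonneg fun _ _ => abs_nonneg _
  -- With this `δ₀`, codeword entropies deviate by at most `n ε / 4` from `n H`, so the midpoint `n
  -- H + n ε / 2` lies in the window of `key` for all of them. The `1` guards against `G = 0`.
  refine ⟨ε / 4 / (1 + G), by positivity, N₁ + N₂ + 1, fun δ hδ hδ₀ n hn => ?_,
    fun n hn s hs => ?_⟩
  · have hn0 : 0 < n := by omega
    obtain ⟨κ, g, hκ⟩ := key n hn (n * H + n * (ε / 2)) (by positivity)
    refine ⟨κ, g, fun s hs => ?_⟩
    have hs' (i : Fin n) : q (s i) ≠ 0 := fun h => (hs (s i)).2 h i rfl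
    have hbound := hs.abs_sum_sub_le hn0 fun a => entropy (σ a)
    rw [← entropy_tensorProd (hdens hs'), ← hH, ← hG] at hbound
    have hδG : δ * G ≤ ε / 4 := by
      rw [le_div_iff₀ (by positivity)] at hδ₀
      nlinarith
    have hle : (n : ℝ) * δ * G ≤ n * (ε / 4) := by
      rw [mul_assoc]
      gcongr
    obtain ⟨hl, hr⟩ := abs_le.mp (hbound.trans hle)
    exact hκ s hs' (by linarith) (by linarith)
  · have h0 := entropy_nonneg (isDensity_tensorProd (hdens hs))
    obtain ⟨κ, g, hκ⟩ := key n hn (entropy (tensorProd fun i => σ (s i)) + n * (ε / 2))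
      (by positivity)
    have : (0 : ℝ) ≤ n * ε := by positivity
    exact ⟨κ, g, hκ s hs (by linarith) (by linarith)⟩

/-! ### Post-measurement states -/

section Measurement

theorem trace_eq_ofReal_re {X : Type*} [Fintype X] {M : Matrix X X ℂ} (hM : M.PosSemidef) :
    M.trace = ((M.trace.re : ℝ) : ℂ) :=
  Complex.eq_re_of_ofReal_le hM.trace_nonneg

theorem isDensity_inv_smul {X : Type*} [Fintype X] {M : Matrix X X ℂ} (hM : M.PosSemidef) {q : ℝ} (hq : M.trace.re = q)
    (hq0 : q ≠ 0) : IsDensity ((q : ℂ)⁻¹ • M) where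
  posSemidef := by
    have h0 : 0 ≤ q := hq ▸ (Complex.le_def.mp hM.trace_nonneg).1
    rw [← Complex.ofReal_inv]
    exact hM.smul (Complex.zero_le_real.mpr (inv_nonneg.mpr h0))
  trace_eq_one := by
    rw [trace_smul, trace_eq_ofReal_re hM, hq, smul_eq_mul]
    exact inv_mul_cancel₀ (by exact_mod_cast hq0)

variable {X S : Type*} [Fintype X] [DecidableEq X]

/-- The post-measurement state `√Λ_s σ √Λ_s / Tr(Λ_s σ)`. -/
noncomputable def measuredState (σ : Matrix X X ℂ) (Λ : S → Matrix X X ℂ) (s : S) : Matrix X X ℂ :=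
  ((outcomeProb σ Λ s : ℂ)⁻¹) • (CFC.sqrt (Λ s) * σ * CFC.sqrt (Λ s))

theorem posSemidef_sqrt_mul_mul_sqrt (M : Matrix X X ℂ) {N : Matrix X X ℂ} (hN : N.PosSemidef) :
    (CFC.sqrt M * N * CFC.sqrt M).PosSemidef := by
  simpa only [conjTranspose_sqrt] using hN.conjTranspose_mul_mul_same (CFC.sqrt M)

theorem trace_sqrt_mul_mul_sqrt {M : Matrix X X ℂ} (hM : M.PosSemidef) (N : Matrix X X ℂ) :
    (CFC.sqrt M * N * CFC.sqrt M).trace = (M * N).trace := by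
  rw [trace_mul_comm, ← Matrix.mul_assoc, sqrt_mul_sqrt hM]

variable {σ : Matrix X X ℂ} {Λ : S → Matrix X X ℂ}

theorem outcomeProb_nonneg (hσ : σ.PosSemidef) (hΛ : ∀ s, (Λ s).PosSemidef) (s : S) :
    0 ≤ outcomeProb σ Λ s := by
  rw [outcomeProb, ← trace_sqrt_mul_mul_sqrt (hΛ s)]
  exact (Complex.le_def.mp (posSemidef_sqrt_mul_mul_sqrt (Λ s) hσ).trace_nonneg).1

theorem seqProb_outcomeProb_nonneg (hσ : σ.PosSemidef) (hΛ : ∀ s, (Λ s).PosSemidef) {n : ℕ}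
    (s : Fin n → S) : 0 ≤ seqProb (outcomeProb σ Λ) s :=
  Finset.prod_nonneg fun i _ => outcomeProb_nonneg hσ hΛ (s i)

theorem isDensity_measuredState (hσ : σ.PosSemidef) (hΛ : ∀ s, (Λ s).PosSemidef) {s : S}
    (hs : outcomeProb σ Λ s ≠ 0) : IsDensity (measuredState σ Λ s) :=
  isDensity_inv_smul (posSemidef_sqrt_mul_mul_sqrt _ hσ)
    (by rw [trace_sqrt_mul_mul_sqrt (hΛ s), outcomeProb]) hs

theorem isDensity_canonState (hσ : σ.PosSemidef) (hΛ : ∀ s, (Λ s).PosSemidef) {s : S}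
    (hs : outcomeProb σ Λ s ≠ 0) : IsDensity (canonState σ Λ s) :=
  isDensity_inv_smul (posSemidef_sqrt_mul_mul_sqrt _ (hΛ s))
    (by rw [trace_sqrt_mul_mul_sqrt hσ, trace_mul_comm, outcomeProb]) hs

/-- With `K = √Λ √σ`, the two states are `Kᴴ K` and `K Kᴴ` up to the same scalar, so their
characteristic polynomials coincide. -/
theorem entropy_canonState (hσ : σ.PosSemidef) (hΛ : ∀ s, (Λ s).PosSemidef) {s : S}
    (hs : outcomeProb σ Λ s ≠ 0) : entropy (canonState σ Λ s) = entropy (measuredState σ Λ s) := by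
  rw [entropy_eq_roots (isDensity_canonState hσ hΛ hs).posSemidef.1,
    entropy_eq_roots (isDensity_measuredState hσ hΛ hs).posSemidef.1]
  have h1 : canonState σ Λ s = ((outcomeProb σ Λ s : ℂ)⁻¹ • (CFC.sqrt σ * CFC.sqrt (Λ s))) *
      (CFC.sqrt (Λ s) * CFC.sqrt σ) := by
    rw [canonState, Matrix.smul_mul, Matrix.mul_assoc _ _ (CFC.sqrt (Λ s) * _),
      ← Matrix.mul_assoc (CFC.sqrt (Λ s)), sqrt_mul_sqrt (hΛ s), ← Matrix.mul_assoc]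
  have h2 : measuredState σ Λ s = (CFC.sqrt (Λ s) * CFC.sqrt σ) *
      ((outcomeProb σ Λ s : ℂ)⁻¹ • (CFC.sqrt σ * CFC.sqrt (Λ s))) := by
    rw [measuredState, Matrix.mul_smul, Matrix.mul_assoc _ _ (CFC.sqrt σ * _),
      ← Matrix.mul_assoc (CFC.sqrt σ), sqrt_mul_sqrt hσ, ← Matrix.mul_assoc]
  rw [h1, h2, charpoly_mul_comm]

theorem reduced_postState_tensorProd {E : Type*} [Fintype E] {n : ℕ} (hσ : σ.PosSemidef)
    (hΛ : ∀ s, (Λ s).PosSemidef) (s : Fin n → S) {ψ : (Fin n → X) × E → ℂ}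
    (hψ : reduced ψ = tensorProd fun _ => σ) :
    reduced (postState (tensorProd fun i => Λ (s i)) (seqProb (outcomeProb σ Λ) s) ψ) =
      tensorProd fun i => measuredState σ Λ (s i) := by
  rw [reduced_postState _ (seqProb_outcomeProb_nonneg hσ hΛ s), hψ,
    sqrt_tensorProd fun i => hΛ (s i), tensorProd_mul, tensorProd_mul]
  simp only [measuredState]
  rw [tensorProd_smul (fun i => (outcomeProb σ Λ (s i) : ℂ)⁻¹)
    fun i => CFC.sqrt (Λ (s i)) * σ * CFC.sqrt (Λ (s i)), seqProb, Finset.prod_inv_distrib]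
  push_cast
  rfl

end Measurement

theorem exists_extraction_of_measurement.{w, v, u} {X : Type v} {S : Type u} [Fintype X]
    [DecidableEq X] [Nonempty X] [Fintype S] [DecidableEq S] {σ : Matrix X X ℂ}
    (hσ : σ.PosSemidef) {Λ : S → Matrix X X ℂ} (hΛ : ∀ s, (Λ s).PosSemidef) {ε : ℝ} (hε : 0 < ε) :
    ∃ δ₀ : ℝ, 0 < δ₀ ∧ ∃ N : ℕ, ∀ δ : ℝ, 0 < δ → δ ≤ δ₀ → ∀ n : ℕ, N ≤ n → ∃ κ g : ℕ,
      ∀ (E : Type w) [Fintype E] (ψ : (Fin n → X) × E → ℂ), reduced ψ = tensorProd (fun _ => σ) →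
      ∀ (L : ℕ) (s : Fin L → Fin n → S),
        (∀ l, StronglyTypical (outcomeProb σ Λ) δ (s l)) →
        ∃ (Q : Fin L → Matrix (Fin n → X) (Fin n → X) ℂ)
          (U : Fin L → Matrix (Fin κ × Fin g) (Fin n → X) ℂ), ∀ l,
          ExtractsPurity ε (U l) (Q l)
            (postState (tensorProd fun i => Λ (s l i)) (seqProb (outcomeProb σ Λ) (s l)) ψ) ∧
          Real.logb 2 (Fintype.card (Fin n → X))
              - entropy (tensorProd fun i => canonState σ Λ (s l i)) - n * ε
            ≤ Real.logb 2 κ := by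
  obtain ⟨δ₀, hδ₀, N, h, -⟩ := exists_hasExtractor.{w} (measuredState σ Λ) (outcomeProb σ Λ)
    (outcomeProb_nonneg hσ hΛ) (fun a => isDensity_measuredState hσ hΛ) hε
  refine ⟨δ₀, hδ₀, N, fun δ hδ hδ' n hn => ?_⟩
  obtain ⟨κ, g, hκ⟩ := h δ hδ hδ' n hn
  refine ⟨κ, g, fun E _ ψ hψ L s hs => ?_⟩
  choose Q U hQU using fun l => (hκ (s l) (hs l)).1
  refine ⟨Q, U, fun l => ⟨hQU l E _ (reduced_postState_tensorProd hσ hΛ (s l) hψ), ?_⟩⟩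
  have hne (i : Fin n) : outcomeProb σ Λ (s l i) ≠ 0 := fun h0 => (hs l _).2 h0 i rfl
  have hent : entropy (tensorProd fun i => canonState σ Λ (s l i)) =
      entropy (tensorProd fun i => measuredState σ Λ (s l i)) := by
    rw [entropy_tensorProd fun i => isDensity_canonState hσ hΛ (hne i),
      entropy_tensorProd fun i => isDensity_measuredState hσ hΛ (hne i)]
    exact Finset.sum_congr rfl fun i _ => entropy_canonState hσ hΛ (hne i)
  rw [hent]
  exact (hκ (s l) (hs l)).2

/-! ### Marginals of the tripartite state -/

section Marginals

theorem posSemidef_sum_submatrix {X Y I : Type*} [Fintype X] [Fintype Y] [Fintype I]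
    {M : Matrix Y Y ℂ} (hM : M.PosSemidef) (f : I → X → Y) :
    (∑ i, M.submatrix (f i) (f i)).PosSemidef :=
  posSemidef_sum _ fun i _ => hM.submatrix (f i)

theorem sum_sum_prod_apply {𝕜 X Y : Type*} [CommSemiring 𝕜] [Fintype X] [Fintype Y] {n : ℕ}
    (f : Fin n → X → Y → 𝕜) :
    ∑ x : Fin n → X, ∑ y : Fin n → Y, ∏ i, f i (x i) (y i) = ∏ i, ∑ x, ∑ y, f i x y := by
  rw [← sum_prod_apply fun i x => ∑ y, f i x y]
  exact Finset.sum_congr rfl fun x _ => sum_prod_apply fun i y => f i (x i) y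

variable {A B C : Type*} {ρ : Matrix (A × B × C) (A × B × C) ℂ}

theorem posSemidef_margA [Fintype A] [Fintype B] [Fintype C] (hρ : ρ.PosSemidef) : (margA ρ).PosSemidef := by
  have : margA ρ = ∑ z : B × C, ρ.submatrix (fun a => (a, z.1, z.2)) (fun a => (a, z.1, z.2)) := by
    ext a a'
    simp [margA, Matrix.sum_apply, Fintype.sum_prod_type]
  exact this ▸ posSemidef_sum_submatrix hρ _

theorem posSemidef_margB [Fintype A] [Fintype B] [Fintype C] (hρ : ρ.PosSemidef) : (margB ρ).PosSemidef := by
  have : margB ρ = ∑ z : A × C, ρ.submatrix (fun b => (z.1, b, z.2)) (fun b => (z.1, b, z.2)) := by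
    ext b b'
    simp [margB, Matrix.sum_apply, Fintype.sum_prod_type]
  exact this ▸ posSemidef_sum_submatrix hρ _

theorem posSemidef_margAB [Fintype A] [Fintype B] [Fintype C] (hρ : ρ.PosSemidef) : (margAB ρ).PosSemidef := by
  have : margAB ρ = ∑ c, ρ.submatrix (fun x => (x.1, x.2, c)) (fun x => (x.1, x.2, c)) := by
    ext x y
    simp [margAB, Matrix.sum_apply]
  exact this ▸ posSemidef_sum_submatrix hρ _

variable {R : Type*} [Fintype R] {n : ℕ} {Ψ : (Fin n → A) × (Fin n → B) × (Fin n → C) × R → ℂ}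

theorem IsPurification.reduced_eq [Fintype B] [Fintype C] (h : IsPurification ρ Ψ) :
    reduced Ψ = tensorProd fun _ => margA ρ := by
  ext a a'
  rw [reduced_apply, Fintype.sum_prod_type]
  simp only [Fintype.sum_prod_type, h a a', tensorProd_apply]
  exact sum_sum_prod_apply fun i b c => ρ (a i, b, c) (a' i, b, c)

theorem IsPurification.reduced_swapFirst_eq [Fintype A] [Fintype C] (h : IsPurification ρ Ψ) :
    reduced (swapFirst Ψ) = tensorProd fun _ => margB ρ := by
  ext b b'
  rw [reduced_apply, Fintype.sum_prod_type]
  simp only [Fintype.sum_prod_type, swapFirst, h _ _ b b', tensorProd_apply]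
  exact sum_sum_prod_apply fun i a c => ρ (a, b i, c) (a, b' i, c)

end Marginals

/-! ### Conditional states of the third party -/

section ConditionalState

/-- The operator `Tr_X {(M ⊗ I) τ}`, for `τ` with blocks `τ c c'`. -/
def blockTrace {X C : Type*} [Fintype X] (M : Matrix X X ℂ) (τ : C → C → Matrix X X ℂ) :
    Matrix C C ℂ :=
  Matrix.of fun c c' => (M * τ c c').trace

/-- Splitting `M` and `τ` into square roots exhibits the block trace as a Gram matrix `G Gᴴ`. -/
theorem posSemidef_blockTrace {X C : Type*} [Fintype X] [DecidableEq X] [Fintype C]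
    {M : Matrix X X ℂ} (hM : M.PosSemidef) {τ : Matrix (X × C) (X × C) ℂ} (hτ : τ.PosSemidef) :
    (blockTrace M fun c c' => Matrix.of fun x y => τ (x, c) (y, c')).PosSemidef := by
  classical
  set N := CFC.sqrt M with hN
  set K := CFC.sqrt τ with hK
  set G : Matrix C (X × X × C) ℂ := Matrix.of fun c z => ∑ y, N z.1 y * K (y, c) z.2 with hG
  convert posSemidef_self_mul_conjTranspose G using 1
  ext c c'
  set T : C → Matrix X (X × C) ℂ := fun c => Matrix.of fun y w => K (y, c) w with hT
  have h1 : (Matrix.of fun x y => τ (x, c) (y, c')) = T c * (T c')ᴴ := by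
    ext x y
    rw [of_apply, ← sqrt_mul_sqrt hτ, ← hK, Matrix.mul_apply, Matrix.mul_apply]
    refine Finset.sum_congr rfl fun w _ => ?_
    exact congrArg (K (x, c) w * ·) (congrFun (congrFun (conjTranspose_sqrt τ) w) (y, c')).symm
  have h2 : (M * (T c * (T c')ᴴ)).trace = ((N * T c) * (N * T c')ᴴ).trace := by
    rw [← sqrt_mul_sqrt hM, ← hN, conjTranspose_mul, hN, conjTranspose_sqrt, trace_mul_comm,
      ← Matrix.mul_assoc, trace_mul_comm]
    simp only [Matrix.mul_assoc]
  rw [blockTrace, of_apply, h1, h2, Matrix.mul_apply, Fintype.sum_prod_type]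
  rfl

/-- `X` is traced out here, so the two factors `√M` meet by cyclicity and only `M` remains; no
canonical state is needed for Charlie. -/
theorem reduced_swapFirst_postState {X C R : Type*} [Fintype X] [DecidableEq X] [Fintype C]
    [Fintype R] {M : Matrix X X ℂ} (hM : M.PosSemidef) {q : ℝ} (hq : 0 ≤ q)
    (φ : X × C × R → ℂ) :
    reduced (swapFirst (postState M q φ)) = (q : ℂ)⁻¹ •
      blockTrace M fun c c' => Matrix.of fun x y => ∑ r, φ (x, c, r) * star (φ (y, c', r)) := by
  ext c c'
  set T : C → Matrix X R ℂ := fun c => Matrix.of fun x r => φ (x, c, r) with hT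
  have h1 : (Matrix.of fun x y => ∑ r, φ (x, c, r) * star (φ (y, c', r))) = T c * (T c')ᴴ := rfl
  have h2 : (M * (T c * (T c')ᴴ)).trace = ((CFC.sqrt M * T c) * (CFC.sqrt M * T c')ᴴ).trace := by
    conv_lhs => rw [← sqrt_mul_sqrt hM]
    rw [conjTranspose_mul, conjTranspose_sqrt, trace_mul_comm,
      ← Matrix.mul_assoc, trace_mul_comm]
    simp only [Matrix.mul_assoc]
  have hs : ((Real.sqrt q : ℂ)⁻¹) * star ((Real.sqrt q : ℂ)⁻¹) = (q : ℂ)⁻¹ := by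
    rw [star_inv₀, Complex.star_def, Complex.conj_ofReal, ← mul_inv, ← Complex.ofReal_mul,
      Real.mul_self_sqrt hq]
  rw [Matrix.smul_apply, blockTrace, of_apply, h1, h2, reduced_apply, Fintype.sum_prod_type,
    smul_eq_mul, Matrix.trace, Finset.mul_sum]
  refine Finset.sum_congr rfl fun x _ => ?_
  rw [diag_apply, Matrix.mul_apply, Finset.mul_sum]
  refine Finset.sum_congr rfl fun r _ => ?_
  have h3 (c : C) : swapFirst (postState M q φ) (c, x, r) =
      (Real.sqrt q : ℂ)⁻¹ * (CFC.sqrt M * T c) x r := rfl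
  rw [h3, h3, conjTranspose_apply, star_mul', ← hs]
  ring

variable {A B C S T : Type*} [Fintype A] [Fintype B] [Fintype C]
  {ρ : Matrix (A × B × C) (A × B × C) ℂ} {ΛA : S → Matrix A A ℂ} {ΛB : T → Matrix B B ℂ}

theorem condStateC_eq (s : S × T) :
    condStateC ρ ΛA ΛB s = ((outcomeProb (margAB ρ) (prodPOVM ΛA ΛB) s : ℂ)⁻¹) •
      blockTrace (prodPOVM ΛA ΛB s)
        fun c c' => Matrix.of fun x y : A × B => ρ (x.1, x.2, c) (y.1, y.2, c') := rfl

theorem posSemidef_prodPOVM (hA : ∀ s, (ΛA s).PosSemidef) (hB : ∀ t, (ΛB t).PosSemidef)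
    (s : S × T) : (prodPOVM ΛA ΛB s).PosSemidef :=
  (hA s.1).kronecker (hB s.2)

theorem isDensity_condStateC [DecidableEq A] [DecidableEq B] (hρ : ρ.PosSemidef) (hA : ∀ s, (ΛA s).PosSemidef)
    (hB : ∀ t, (ΛB t).PosSemidef) {s : S × T}
    (hs : outcomeProb (margAB ρ) (prodPOVM ΛA ΛB) s ≠ 0) : IsDensity (condStateC ρ ΛA ΛB s) := by
  rw [condStateC_eq]
  refine isDensity_inv_smul (posSemidef_blockTrace (posSemidef_prodPOVM hA hB s)
    (hρ.submatrix fun z : (A × B) × C => (z.1.1, z.1.2, z.2))) ?_ hs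
  have hsum : margAB ρ = ∑ c, Matrix.of fun x y : A × B => ρ (x.1, x.2, c) (y.1, y.2, c) := by
    ext x y
    simp [margAB, Matrix.sum_apply]
  rw [outcomeProb, hsum, Finset.mul_sum, trace_sum]
  rfl

theorem reduced_swapFirst_postState_groupFirst [DecidableEq A] [DecidableEq B] {R : Type*} [Fintype R] {n : ℕ}
    {Ψ : (Fin n → A) × (Fin n → B) × (Fin n → C) × R → ℂ} (h : IsPurification ρ Ψ)
    (hρ : ρ.PosSemidef) (hA : ∀ s, (ΛA s).PosSemidef) (hB : ∀ t, (ΛB t).PosSemidef)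
    (u : Fin n → S) (v : Fin n → T) :
    reduced (swapFirst (postState
        ((tensorProd fun i => ΛA (u i)) ⊗ₖ (tensorProd fun i => ΛB (v i)))
        (seqProb (outcomeProb (margAB ρ) (prodPOVM ΛA ΛB)) fun i => (u i, v i))
        (groupFirst Ψ))) =
      tensorProd fun i => condStateC ρ ΛA ΛB (u i, v i) := by
  rw [reduced_swapFirst_postState ((posSemidef_tensorProd fun i => hA (u i)).kronecker
    (posSemidef_tensorProd fun i => hB (v i))) 
      (seqProb_outcomeProb_nonneg (posSemidef_margAB hρ) (posSemidef_prodPOVM hA hB) _)]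
  simp only [condStateC]
  rw [tensorProd_smul (fun i => (outcomeProb (margAB ρ) (prodPOVM ΛA ΛB) (u i, v i) : ℂ)⁻¹),
    seqProb, Finset.prod_inv_distrib]
  push_cast
  congr 1
  ext c c'
  rw [blockTrace, of_apply, tensorProd_apply]
  simp only [of_apply, ← sum_sum_prod_apply]
  -- The product of conditional states sums over sequences of pairs, the `n`-fold vector over pairs
  -- of sequences.
  have hsum (F : (Fin n → A × B) → ℂ) :
      ∑ x, F x = ∑ x : (Fin n → A) × (Fin n → B), F fun i => (x.1 i, x.2 i) :=
    Fintype.sum_equiv (Equiv.arrowProdEquivProdArrow (Fin n) (fun _ => A) (fun _ => B)) _ _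
      fun x => rfl
  rw [hsum]
  simp only [Matrix.trace, diag_apply, Matrix.mul_apply]
  refine Finset.sum_congr rfl fun x _ => ?_
  rw [hsum]
  refine Finset.sum_congr rfl fun y _ => ?_
  have hP : ∑ r, groupFirst Ψ (y, c, r) * star (groupFirst Ψ (x, c', r)) = _ :=
    h y.1 x.1 y.2 x.2 c c'
  rw [of_apply, hP, tensorProd_apply, Finset.prod_mul_distrib]
  simp only [prodPOVM, kroneckerMap_apply, tensorProd_apply, Finset.prod_mul_distrib]

end ConditionalState

end PurityDistillation

theorem mainTheorem4
    {A B C 𝒰 𝒱 : Type*}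
    [Fintype A] [DecidableEq A] [Fintype B] [DecidableEq B] [Fintype C] [DecidableEq C]
    [Fintype 𝒰] [DecidableEq 𝒰] [Fintype 𝒱] [DecidableEq 𝒱]
    (ρ : Matrix (A × B × C) (A × B × C) ℂ) (hρ : IsDensity ρ)
    (ΛA : 𝒰 → Matrix A A ℂ) (hΛA : IsPOVM ΛA)
    (ΛB : 𝒱 → Matrix B B ℂ) (hΛB : IsPOVM ΛB)
    -- the outcome distributions
    (lamA : 𝒰 → ℝ) (hlamA : lamA = outcomeProb (margA ρ) ΛA)
    (lamB : 𝒱 → ℝ) (hlamB : lamB = outcomeProb (margB ρ) ΛB)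
    (lamAB : 𝒰 × 𝒱 → ℝ) (hlamAB : lamAB = outcomeProb (margAB ρ) (prodPOVM ΛA ΛB))
    (ε : ℝ) (hε : 0 < ε) :
    ∃ δ₀ : ℝ, 0 < δ₀ ∧ ∃ N : ℕ, ∀ δ : ℝ, 0 < δ → δ ≤ δ₀ → ∀ n : ℕ, N ≤ n →
    -- dimensions of the purity and garbage registers of the three parties
    ∃ κA gA κB gB κC gC : ℕ,
    -- a purification of the `n`-fold state, and codebooks of typical sequences
    ∀ (R : Type*) [Fintype R]
      (Ψ : (Fin n → A) × (Fin n → B) × (Fin n → C) × R → ℂ), IsPurification ρ Ψ →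
    ∀ (L K : ℕ) (u : Fin L → Fin n → 𝒰) (v : Fin K → Fin n → 𝒱),
      (∀ l, StronglyTypical lamA δ (u l)) → (∀ k, StronglyTypical lamB δ (v k)) →
    -- Alice
    (∃ (Q : Fin L → Matrix (Fin n → A) (Fin n → A) ℂ)
        (U : Fin L → Matrix (Fin κA × Fin gA) (Fin n → A) ℂ), ∀ l,
      ExtractsPurity ε (U l) (Q l)
        (postState (tensorProd fun i => ΛA (u l i)) (seqProb lamA (u l)) Ψ) ∧
      Real.logb 2 (Fintype.card (Fin n → A))
          - entropy (tensorProd fun i => canonState (margA ρ) ΛA (u l i)) - n * ε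
        ≤ Real.logb 2 κA) ∧
    -- Bob
    (∃ (Q : Fin K → Matrix (Fin n → B) (Fin n → B) ℂ)
        (U : Fin K → Matrix (Fin κB × Fin gB) (Fin n → B) ℂ), ∀ k,
      ExtractsPurity ε (U k) (Q k)
        (postState (tensorProd fun i => ΛB (v k i)) (seqProb lamB (v k)) (swapFirst Ψ)) ∧
      Real.logb 2 (Fintype.card (Fin n → B))
          - entropy (tensorProd fun i => canonState (margB ρ) ΛB (v k i)) - n * ε
        ≤ Real.logb 2 κB) ∧
    -- Charlie: all pairs of positive probability; one pair of registers for the jointly typical ones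
    (∃ (κ g : Fin L → Fin K → ℕ)
        (Q : Fin L → Fin K → Matrix (Fin n → C) (Fin n → C) ℂ)
        (U : ∀ l k, Matrix (Fin (κ l k) × Fin (g l k)) (Fin n → C) ℂ), ∀ l k,
      (StronglyTypical lamAB δ (fun i => (u l i, v k i)) → κ l k = κC ∧ g l k = gC) ∧
      (0 < seqProb lamAB (fun i => (u l i, v k i)) →
        ExtractsPurity ε (U l k) (Q l k)
          (swapFirst (postState
            ((tensorProd fun i => ΛA (u l i)) ⊗ₖ (tensorProd fun i => ΛB (v k i)))
            (seqProb lamAB (fun i => (u l i, v k i))) (groupFirst Ψ))) ∧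
        Real.logb 2 (Fintype.card (Fin n → C))
            - entropy (tensorProd fun i => condStateC ρ ΛA ΛB (u l i, v k i)) - n * ε
          ≤ Real.logb 2 (κ l k))) := by
  subst hlamA hlamB hlamAB
  have hA := hΛA.posSemidef
  have hB := hΛB.posSemidef
  have hρ0 := hρ.posSemidef
  obtain ⟨⟨a₀, b₀, c₀⟩⟩ : Nonempty (A × B × C) := by
    by_contra h
    rw [not_nonempty_iff] at h
    simpa [Matrix.trace] using hρ.trace_eq_one
  have : Nonempty A := ⟨a₀⟩
  have : Nonempty B := ⟨b₀⟩
  have : Nonempty C := ⟨c₀⟩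
  obtain ⟨δA, hδA, NA, hAlice⟩ := exists_extraction_of_measurement (posSemidef_margA hρ0) hA hε
  obtain ⟨δB, hδB, NB, hBob⟩ := exists_extraction_of_measurement (posSemidef_margB hρ0) hB hε
  obtain ⟨δC, hδC, NC, hCtyp, hCall⟩ := exists_hasExtractor (condStateC ρ ΛA ΛB)
    (outcomeProb (margAB ρ) (prodPOVM ΛA ΛB))
    (outcomeProb_nonneg (posSemidef_margAB hρ0) (posSemidef_prodPOVM hA hB))
    (fun s hs => isDensity_condStateC hρ0 hA hB hs) hε
  refine ⟨min δA (min δB δC), by positivity, NA + NB + NC, fun δ hδ hδ₀ n hn => ?_⟩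
  obtain ⟨κA, gA, hAlice⟩ := hAlice δ hδ (hδ₀.trans (min_le_left _ _)) n (by omega)
  obtain ⟨κB, gB, hBob⟩ := hBob δ hδ
    (hδ₀.trans ((min_le_right _ _).trans (min_le_left _ _))) n (by omega)
  obtain ⟨κC, gC, hCtyp⟩ := hCtyp δ hδ
    (hδ₀.trans ((min_le_right _ _).trans (min_le_right _ _))) n (by omega)
  refine ⟨κA, gA, κB, gB, κC, gC, fun R _ Ψ hΨ L K u v hu hv =>
    ⟨hAlice _ Ψ hΨ.reduced_eq L u hu, hBob _ (swapFirst Ψ) hΨ.reduced_swapFirst_eq K v hv, ?_⟩⟩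
  have hdims (l : Fin L) (k : Fin K) : ∃ κ g : ℕ,
      (StronglyTypical (outcomeProb (margAB ρ) (prodPOVM ΛA ΛB)) δ (fun i => (u l i, v k i)) →
        κ = κC ∧ g = gC) ∧
      (0 < seqProb (outcomeProb (margAB ρ) (prodPOVM ΛA ΛB)) (fun i => (u l i, v k i)) →
        HasExtractor ε (n * ε) (tensorProd fun i => condStateC ρ ΛA ΛB (u l i, v k i)) κ g) := by
    by_cases htyp : StronglyTypical (outcomeProb (margAB ρ) (prodPOVM ΛA ΛB)) δ
        (fun i => (u l i, v k i))
    · exact ⟨κC, gC, fun _ => ⟨rfl, rfl⟩, fun _ => hCtyp _ htyp⟩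
    by_cases hpos : 0 < seqProb (outcomeProb (margAB ρ) (prodPOVM ΛA ΛB))
        (fun i => (u l i, v k i))
    · obtain ⟨κ, g, h⟩ := hCall n (by omega) (fun i => (u l i, v k i)) fun i =>
        Finset.prod_ne_zero_iff.mp hpos.ne' i (Finset.mem_univ i)
      exact ⟨κ, g, fun h' => absurd h' htyp, fun _ => h⟩
    · exact ⟨0, 0, fun h' => absurd h' htyp, fun h' => absurd h' hpos⟩
  choose κ g hκg using hdims
  have hQU (l : Fin L) (k : Fin K) :
      ∃ (Q : Matrix (Fin n → C) (Fin n → C) ℂ) (U : Matrix (Fin (κ l k) × Fin (g l k)) (Fin n → C) ℂ),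
      0 < seqProb (outcomeProb (margAB ρ) (prodPOVM ΛA ΛB)) (fun i => (u l i, v k i)) →
        ExtractsPurity ε U Q (swapFirst (postState
          ((tensorProd fun i => ΛA (u l i)) ⊗ₖ (tensorProd fun i => ΛB (v k i)))
          (seqProb (outcomeProb (margAB ρ) (prodPOVM ΛA ΛB)) (fun i => (u l i, v k i)))
          (groupFirst Ψ))) := by
    by_cases hpos : 0 < seqProb (outcomeProb (margAB ρ) (prodPOVM ΛA ΛB))
        (fun i => (u l i, v k i))
    · obtain ⟨⟨Q, U, h⟩, -⟩ := (hκg l k).2 hpos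
      exact ⟨Q, U, fun _ => h _ _
        (reduced_swapFirst_postState_groupFirst hΨ hρ0 hA hB (u l) (v k))⟩
    · exact ⟨0, 0, fun h => absurd h hpos⟩
  choose Q U hQU using hQU
  exact ⟨κ, g, Q, U, fun l k => ⟨(hκg l k).1, fun hpos => ⟨hQU l k hpos, ((hκg l k).2 hpos).2⟩⟩⟩
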